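/- **Corollary ($L_p$ Brunn concavity principle).** Let $p\ge 1$ and $1/q=1-1/p$. For $\lambda,t\in[0,1]$ put $$C_{p,\lambda,t}=(1-t)^{1/p}(1-\lambda)^{1/q},\qquad D_{p,\lambda,t}=t^{1/p}\lambda^{1/q}$$ (for $p=1$: $C=1-t$, $D=t$). For $s\in[-\infty,\infty]$, $\alpha,\beta\ge0$ and $a,b\in[0,\infty]$ let $M_s^{(\alpha,\beta)}(a,b)=0$ if $a=0$ or $b=0$, and otherwise $$M_s^{(\alpha,\beta)}(a,b)=\begin{cases}(\alpha a^s+\beta b^s)^{1/s}, & s\ne0,\pm\infty,\\ a^\alpha b^\beta, & s=0,\\ \max\{a,b\}, & s=+\infty,\\ \min\{a,b\}, & s=-\infty.\end{cases}$$ A function $g\ge 0$ (the value $+\infty$ being allowed) on a real vector space is *$L_{p,s}$-concave* if $$g(Cx+Dy)\ \ge\ M_s^{(C,D)}(g(x),g(y)),\qquad C=C_{p,\lambda,t},\ D=D_{p,\lambda,t},$$ for all $x,y$ and all $\lambda,t\in[0,1]$ with $(C,D)\neq(0,0)$. For real $r$, it is *$L_{p,r}$-quasi-concave* if $g(Cx+Dy)\ge\min\{C^r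 g(x),D^r g(y)\}$ for all $x,y$ and all $\lambda,t\in[0,1]$. Let $0\le j<n$, let $K\subset\mathbb R^n$ be a convex body containing the origin in its interior, and let $H\subset\mathbb R^n$ be an $(n-j)$-dimensional linear subspace. Let $s\in[-\infty,\infty]$ and let $\mu$ be a measure on $\mathbb R^n$ whose density $f:\mathbb R^n\to[0,\infty)$ is measurable and $L_{p,s}$-concave. For $x\in\mathbb R^n$ put $$\Omega(x)=\mu(K\cap(x+H)):=\int_{K\cap(x+H)}f(z)\,dz\in[0,\infty],$$ the integral being with respect to $(n-j)$-dimensional Lebesgue measure on $x+H$. Let $\gamma=\dfrac{s}{1+(n-j)s}$, with the limiting values $\gamma=\frac1{n-j}$ for $s=\pm\infty$ and $\gamma=-\infty$ for $s=-\frac1{n-j}$. Then: 1. if $s\ge-\frac1{n-j}$ and $s\neq0$, then $\Omega$ is $L_{p,\gamma}$-concave; if $s=0$, then $\Omega$ is log-concave, i.e. $L_{1,0}$-concave; 2. if $s<-\frac1{n-j}$, then $\Omega$ is $L_{p,1/\gamma}$-quasi-concave, where $\frac1\gamma=n-j+\frac1s$ (equal to $n-j$ for $s=-\infty$). Because $M$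 vanishes as soon as one of its two arguments does, and the minimum in the definition of quasi-concavity (here $1/\gamma>0$) does so too, these are statements about $\Omega$ on its support $\{\Omega>0\}$. -/

import Mathlib

open MeasureTheory
open scoped ENNReal NNReal

noncomputable section

/-- The `L_p` coefficient `C_{p,l,t} = (1-t)^{1/p} (1-l)^{1/q}`, where `1/q = 1 - 1/p`.
For `p = 1` the exponent `1/q` is `0` and the coefficient is `1 - t` (with `0 ^ 0 = 1`). -/
def lpCoeffC (p l t : ℝ) : ℝ := (1 - t) ^ (1 / p) * (1 - l) ^ (1 - 1 / p)

/-- The `L_p` coefficient `D_{p,l,t} = t^{1/p} l^{1/q}`, where `1/q = 1 - 1/p`. -/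
def lpCoeffD (p l t : ℝ) : ℝ := t ^ (1 / p) * l ^ (1 - 1 / p)

open Classical in
/-- The `s`-mean `M_s^{(α,β)}(a,b)` of `a, b ∈ [0,∞]`, for `s ∈ [-∞,∞]` and weights `α, β ≥ 0`
whose sum need not be `1`. It is `0` as soon as `a = 0` or `b = 0`. -/
def sMean (s : EReal) (α β : ℝ) (a b : ℝ≥0∞) : ℝ≥0∞ :=
  if a = 0 ∨ b = 0 then 0
  else if s = ⊤ then max a b
  else if s = ⊥ then min a b
  else if s = 0 then a ^ α * b ^ β
  else (ENNReal.ofReal α * a ^ s.toReal + ENNReal.ofReal β * b ^ s.toReal) ^ (1 / s.toReal)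

/-- `L_{p,s}`-concavity of a function with values in `[0,∞]`. The completely degenerate
weights `C = D = 0` (they occur only for `p > 1` and `{l, t} = {0, 1}`), for which the mean
`(C a^s + D b^s)^{1/s}` has no meaning when `s < 0`, are left out. -/
def IsLpConcave {V : Type*} [AddCommGroup V] [Module ℝ V]
    (p : ℝ) (s : EReal) (g : V → ℝ≥0∞) : Prop :=
  ∀ x y : V, ∀ l ∈ Set.Icc (0 : ℝ) 1, ∀ t ∈ Set.Icc (0 : ℝ) 1,
    (lpCoeffC p l t ≠ 0 ∨ lpCoeffD p l t ≠ 0) →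
      sMean s (lpCoeffC p l t) (lpCoeffD p l t) (g x) (g y)
        ≤ g (lpCoeffC p l t • x + lpCoeffD p l t • y)

/-- `L_{p,r}`-quasi-concavity:
`g (C x + D y) ≥ min {C^r g(x), D^r g(y)}` for all `x, y` and all `l, t ∈ [0,1]`. -/
def IsLpQuasiConcave {V : Type*} [AddCommGroup V] [Module ℝ V]
    (p r : ℝ) (g : V → ℝ≥0∞) : Prop :=
  ∀ x y : V, ∀ l ∈ Set.Icc (0 : ℝ) 1, ∀ t ∈ Set.Icc (0 : ℝ) 1,
    min (ENNReal.ofReal (lpCoeffC p l t) ^ r * g x) (ENNReal.ofReal (lpCoeffD p l t) ^ r * g y)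
      ≤ g (lpCoeffC p l t • x + lpCoeffD p l t • y)

open Classical in
/-- The exponent `γ = s / (1 + k s)`, with its limiting values: `1/k` at `s = ±∞`, and `-∞` at
`s = -1/k` (approached from the right). -/
def brunnExponent (k : ℕ) (s : EReal) : EReal :=
  if s = ⊤ ∨ s = ⊥ then ((1 / (k : ℝ) : ℝ) : EReal)
  else if 1 + (k : ℝ) * s.toReal = 0 then ⊥
  else ((s.toReal / (1 + (k : ℝ) * s.toReal) : ℝ) : EReal)

/-- The mass `μ(K ∩ (x + H))` of the section of `K` by the affine subspace `x + H`, for the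
measure with density `f`: the integral of `f` over `K ∩ (x + H)` with respect to the
`(dim H)`-dimensional Lebesgue measure of `x + H`. -/
def sectionMass {n : ℕ} (f : EuclideanSpace ℝ (Fin n) → ℝ≥0) (K : Set (EuclideanSpace ℝ (Fin n)))
    (H : Submodule ℝ (EuclideanSpace ℝ (Fin n))) (x : EuclideanSpace ℝ (Fin n)) : ℝ≥0∞ :=
  ∫⁻ u : H in {u : H | x + (u : EuclideanSpace ℝ (Fin n)) ∈ K},
    (f (x + (u : EuclideanSpace ℝ (Fin n))) : ℝ≥0∞)

end

/-! By AM-GM the coefficients satisfy `C + D ≤ 1`, so a convex `K` containing the origin is stable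
under `(x, y) ↦ C x + D y`. The densities of the sections, cut off outside `K`, thus inherit the
mean inequality of `f`, and what remains is a Borell–Brascamp–Lieb inequality on `H`, of dimension
`k = n - j > 0`, for weights of arbitrary sum.

Its core is `NegMeanInequality`: if `(Φ(u)^(-1/k) + Ψ(v)^(-1/k))^(-k) ≤ h(u + v)`, then `min (∫Φ)
(∫Ψ) ≤ ∫h`. On the line it follows from `|A| + |B| ≤ |A + B|` by layer cake;
`NegMeanInequality.prod_real` raises the dimension by Fubini.

For `s ≥ -1/k`, `s ≠ 0`, and auxiliary weights `α + β = 1`, the means of exponents `-1/k` and `s`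
are compared. After dilation by `C` and `D` the core gives `min ((C/α)^(1/γ) I) ((D/β)^(1/γ) J) ≤
X`, where `1/γ = k + 1/s`, and the best `α` turns the left side into the `γ`-mean
(`rpow_mean_le_of_forall_weights`). For `s < -1/k` unweighted sums are compared instead, and the
minimum itself remains. For `s = 0` the same core yields Prékopa–Leindler. -/

/-! ### The inequality on the line. -/

theorem volume_add_volume_le_of_add_mem {A B S : Set ℝ} (hA : MeasurableSet A)
    (hB : MeasurableSet B) (hA0 : A.Nonempty) (hB0 : B.Nonempty)
    (hS : ∀ x ∈ A, ∀ y ∈ B, x + y ∈ S) : volume A + volume B ≤ volume S := by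
  have compact_case : ∀ A' ⊆ A, IsCompact A' → A'.Nonempty → ∀ B' ⊆ B, IsCompact B' →
      B'.Nonempty → volume A' + volume B' ≤ volume S := by
    intro A' hA' cA nA B' hB' cB nB
    obtain ⟨a, ha, hamax⟩ := cA.exists_isGreatest nA
    obtain ⟨b, hb, hbmin⟩ := cB.exists_isLeast nB
    -- The translates `A' + b` and `a + B'`, with `a = max A'` and `b = min B'`, lie in `S` and meet
    -- at most in `a + b`.
    have e1 : volume ((fun x => x + (-b)) ⁻¹' A') = volume A' := measure_preimage_add_right _ _ _
    have e2 : volume ((fun x => (-a) + x) ⁻¹' B') = volume B' := measure_preimage_add _ _ _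
    rw [← e1, ← e2, ← measure_union₀ ((cB.measurableSet.preimage (by fun_prop)).nullMeasurableSet)]
    · apply measure_mono
      rintro x (hx | hx)
      · simpa using hS _ (hA' hx) _ (hB' hb)
      · simpa using hS _ (hA' ha) _ (hB' hx)
    · refine measure_mono_null (t := {a + b}) ?_ (by simp)
      rintro x ⟨hx, hy⟩
      have h1 := hamax hx
      have h2 := hbmin hy
      simp only [Set.mem_singleton_iff]
      linarith
  have inner_reg : ∀ T : Set ℝ, MeasurableSet T → T.Nonempty → volume T ≤
      ⨆ T', ⨆ (_ : T' ⊆ T ∧ IsCompact T' ∧ T'.Nonempty), volume T' := by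
    rintro T hT ⟨x, hx⟩
    refine le_of_forall_lt fun c hc => ?_
    obtain ⟨T', hT', cT', hcT'⟩ := hT.exists_lt_isCompact hc
    refine hcT'.trans_le ((measure_mono Set.subset_union_left).trans
      (le_iSup₂_of_le (T' ∪ {x}) ⟨?_, cT'.union isCompact_singleton, x, by simp⟩ le_rfl))
    exact Set.union_subset hT' (Set.singleton_subset_iff.2 hx)
  refine (add_le_add (inner_reg A hA hA0) (inner_reg B hB hB0)).trans
    (ENNReal.biSup_add_biSup_le' ?_ ?_ ?_)
  · exact ⟨{hA0.some}, Set.singleton_subset_iff.2 hA0.some_mem, isCompact_singleton, by simp⟩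
  · exact ⟨{hB0.some}, Set.singleton_subset_iff.2 hB0.some_mem, isCompact_singleton, by simp⟩
  · rintro A' ⟨h1, h2, h3⟩ B' ⟨h4, h5, h6⟩
    exact compact_case A' h1 h2 h3 B' h4 h5 h6

/-- The superlevel sets of `h` dominate those of `φ` and `ψ` below a common supremum `1`. -/
theorem lintegral_add_le_of_min_le {φ ψ h : ℝ → ℝ≥0∞} (hφ : Measurable φ) (hψ : Measurable ψ)
    (hh : Measurable h) (hφ1 : ⨆ x, φ x = 1) (hψ1 : ⨆ x, ψ x = 1)
    (hle : ∀ x y, min (φ x) (ψ y) ≤ h (x + y)) :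
    (∫⁻ x, φ x) + ∫⁻ x, ψ x ≤ ∫⁻ x, h x := by
  have layer : ∀ g : ℝ → ℝ≥0∞, Measurable g → (∀ x, g x ≤ 1) →
      ∫⁻ x, g x = ∫⁻ t in Set.Ioo (0 : ℝ) 1, volume {x | ENNReal.ofReal t < g x} := by
    intro g hg hg1
    have h1 : ∫⁻ x, g x = ∫⁻ x, ENNReal.ofReal (g x).toReal :=
      lintegral_congr fun x => (ENNReal.ofReal_toReal ((hg1 x).trans_lt ENNReal.one_lt_top).ne).symm
    rw [h1, lintegral_eq_lintegral_meas_lt _ (Filter.Eventually.of_forall fun x =>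
      ENNReal.toReal_nonneg) hg.ennreal_toReal.aemeasurable]
    have h2 : ∀ t ∈ Set.Ioi (0 : ℝ), volume {x | t < (g x).toReal}
        = volume {x | ENNReal.ofReal t < g x} := by
      intro t ht
      congr 1
      ext x
      exact (ENNReal.ofReal_lt_iff_lt_toReal (le_of_lt ht)
        ((hg1 x).trans_lt ENNReal.one_lt_top).ne).symm
    rw [setLIntegral_congr_fun measurableSet_Ioi h2]
    have h3 : Set.Ioi (0 : ℝ) = Set.Ioo 0 1 ∪ Set.Ici 1 := by
      rw [Set.Ioo_union_Ici_eq_Ioi one_pos]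
    rw [h3, lintegral_union measurableSet_Ici]
    · have h4 : ∫⁻ t in Set.Ici (1 : ℝ), volume {x | ENNReal.ofReal t < g x} = 0 := by
        rw [setLIntegral_congr_fun (g := fun _ => 0) measurableSet_Ici]
        · simp
        · intro t ht
          have : {x | ENNReal.ofReal t < g x} = ∅ := by
            ext x
            simp only [Set.mem_ofPred_eq, Set.mem_empty_iff_false, iff_false, not_lt]
            exact (hg1 x).trans (by simpa using ENNReal.ofReal_le_ofReal ht)
          simp [this]
      rw [h4, add_zero]
    · rw [Set.disjoint_left]
      rintro x ⟨_, hx⟩ hx'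
      exact absurd hx (not_lt.2 hx')
  have hφle : ∀ x, φ x ≤ 1 := fun x => hφ1 ▸ le_iSup φ x
  have hψle : ∀ x, ψ x ≤ 1 := fun x => hψ1 ▸ le_iSup ψ x
  calc (∫⁻ x, φ x) + ∫⁻ x, ψ x
      ≤ ∫⁻ t in Set.Ioo (0 : ℝ) 1, volume {x | ENNReal.ofReal t < min (h x) 1} := by
        rw [layer φ hφ hφle, layer ψ hψ hψle]
        refine (le_lintegral_add _ _).trans (setLIntegral_mono' measurableSet_Ioo fun t ht => ?_)
        have ht1 : ENNReal.ofReal t < 1 := by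
          rw [← ENNReal.ofReal_one]
          exact (ENNReal.ofReal_lt_ofReal_iff one_pos).2 ht.2
        -- Both superlevel sets are nonempty, as the suprema are `1` and `t < 1`; this is why the
        -- two functions are normalised.
        refine volume_add_volume_le_of_add_mem (measurableSet_lt measurable_const hφ)
          (measurableSet_lt measurable_const hψ) ?_ ?_ ?_
        · exact lt_iSup_iff.1 (hφ1 ▸ ht1)
        · exact lt_iSup_iff.1 (hψ1 ▸ ht1)
        · intro x hx y hy
          exact lt_min ((lt_min hx hy).trans_le (hle x y)) ht1
    _ = ∫⁻ x, min (h x) 1 := (layer _ (hh.min measurable_const) fun x => min_le_right _ _).symm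
    _ ≤ ∫⁻ x, h x := lintegral_mono fun x => min_le_left _ _

/-- The mean `(a^(-1/k) + b^(-1/k))^(-k)`, which is invariant under dilations of `ℝ^k`. -/
noncomputable def negMean (k : ℝ) (a b : ℝ≥0∞) : ℝ≥0∞ := (a ^ (-1 / k) + b ^ (-1 / k)) ^ (-k)

theorem negMean_mono {k : ℝ} (hk : 0 < k) {a b a' b' : ℝ≥0∞} (ha : a ≤ a') (hb : b ≤ b') :
    negMean k a b ≤ negMean k a' b' := by
  have key : ∀ {x y : ℝ≥0∞} {r : ℝ}, 0 < r → x ≤ y → y ^ (-r) ≤ x ^ (-r) := by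
    intro x y r hr h
    rw [ENNReal.rpow_neg, ENNReal.rpow_neg]
    exact ENNReal.inv_le_inv.2 (ENNReal.rpow_le_rpow h hr.le)
  have e : -1 / k = -(1 / k) := by ring
  unfold negMean
  rw [e]
  have := one_div_pos.2 hk
  exact key hk (add_le_add (key this ha) (key this hb))

theorem negMean_one (a b : ℝ≥0∞) : negMean 1 a b = (a⁻¹ + b⁻¹)⁻¹ := by
  simp [negMean, ENNReal.rpow_neg_one]

theorem tendsto_lintegral_min_natCast {α : Type*} [MeasurableSpace α] (μ : Measure α)
    {f : α → ℝ≥0∞} (hf : Measurable f) :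
    Filter.Tendsto (fun n : ℕ => ∫⁻ x, min (f x) n ∂μ) Filter.atTop (nhds (∫⁻ x, f x ∂μ)) := by
  refine lintegral_tendsto_of_tendsto_of_monotone
    (fun n => (hf.min measurable_const).aemeasurable)
    (Filter.Eventually.of_forall fun x => ?_) (Filter.Eventually.of_forall fun x => ?_)
  · intro m n hmn
    exact min_le_min le_rfl (by exact_mod_cast hmn)
  · have := (tendsto_const_nhds (x := f x)).min ENNReal.tendsto_nat_nhds_top
    simpa using this

/-- With `A = sup Φ` and `B = sup Ψ`, the harmonic hypothesis gives `min (Φ/A) (Ψ/B) ≤ (A⁻¹ + B⁻¹)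
h`. Hence `A⁻¹ ∫Φ + B⁻¹ ∫Ψ ≤ (A⁻¹ + B⁻¹) ∫h`, and the left side is at least `(A⁻¹ + B⁻¹)` times the
minimum. -/
theorem min_lintegral_le_of_negMean_one_le {Φ Ψ h : ℝ → ℝ≥0∞} (hΦ : Measurable Φ)
    (hΨ : Measurable Ψ) (hh : Measurable h) (hle : ∀ x y, negMean 1 (Φ x) (Ψ y) ≤ h (x + y)) :
    min (∫⁻ x, Φ x) (∫⁻ x, Ψ x) ≤ ∫⁻ x, h x := by
  have bounded : ∀ Φ Ψ : ℝ → ℝ≥0∞, Measurable Φ → Measurable Ψ → (⨆ x, Φ x) ≠ ∞ →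
      (⨆ x, Ψ x) ≠ ∞ → (∀ x y, negMean 1 (Φ x) (Ψ y) ≤ h (x + y)) →
      min (∫⁻ x, Φ x) (∫⁻ x, Ψ x) ≤ ∫⁻ x, h x := by
    intro Φ Ψ hΦ hΨ hA hB hle
    set A := ⨆ x, Φ x with hAdef
    set B := ⨆ x, Ψ x with hBdef
    by_cases hA0 : A = 0
    · have : ∀ x, Φ x = 0 := by simpa [hAdef] using hA0
      simp [this]
    by_cases hB0 : B = 0
    · have : ∀ x, Ψ x = 0 := by simpa [hBdef] using hB0
      simp [this]
    have hAB0 : A⁻¹ + B⁻¹ ≠ 0 := by simp [hA]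
    have hABt : A⁻¹ + B⁻¹ ≠ ∞ := by simp [hA0, hB0]
    have key := lintegral_add_le_of_min_le (φ := fun x => A⁻¹ * Φ x) (ψ := fun x => B⁻¹ * Ψ x)
      (h := fun x => (A⁻¹ + B⁻¹) * h x) (hΦ.const_mul _) (hΨ.const_mul _) (hh.const_mul _)
      (by rw [← ENNReal.mul_iSup, ENNReal.inv_mul_cancel hA0 hA])
      (by rw [← ENNReal.mul_iSup, ENNReal.inv_mul_cancel hB0 hB])
      (by
        intro x y
        refine le_trans ?_ (mul_le_mul_right (hle x y) _)
        rw [negMean_one, ← div_eq_mul_inv]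
        set m := min (A⁻¹ * Φ x) (B⁻¹ * Ψ y)
        have h1 : A * m ≤ Φ x := by
          calc A * m ≤ A * (A⁻¹ * Φ x) := by gcongr; exact min_le_left _ _
            _ = Φ x := by rw [← mul_assoc, ENNReal.mul_inv_cancel hA0 hA, one_mul]
        have h2 : B * m ≤ Ψ y := by
          calc B * m ≤ B * (B⁻¹ * Ψ y) := by gcongr; exact min_le_right _ _
            _ = Ψ y := by rw [← mul_assoc, ENNReal.mul_inv_cancel hB0 hB, one_mul]
        rcases eq_or_ne m 0 with h0 | h0
        · simp [h0]
        have hm : m ≠ ∞ := ((min_le_left _ _).trans_lt (lt_of_le_of_lt (b := 1) (by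
            calc A⁻¹ * Φ x ≤ A⁻¹ * A := by gcongr; exact le_iSup Φ x
              _ = 1 := ENNReal.inv_mul_cancel hA0 hA) ENNReal.one_lt_top)).ne
        rw [ENNReal.le_div_iff_mul_le]
        · calc m * ((Φ x)⁻¹ + (Ψ y)⁻¹) ≤ m * ((A * m)⁻¹ + (B * m)⁻¹) := by gcongr
            _ = A⁻¹ + B⁻¹ := by
              rw [ENNReal.mul_inv (Or.inl hA0) (Or.inl hA), ENNReal.mul_inv (Or.inl hB0) (Or.inl hB),
                ← add_mul, mul_comm, mul_assoc, ENNReal.inv_mul_cancel h0 hm, mul_one]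
        · exact Or.inr hAB0
        · exact Or.inr hABt)
    rw [lintegral_const_mul _ hΦ, lintegral_const_mul _ hΨ, lintegral_const_mul _ hh] at key
    have : (A⁻¹ + B⁻¹) * min (∫⁻ x, Φ x) (∫⁻ x, Ψ x) ≤ (A⁻¹ + B⁻¹) * ∫⁻ x, h x := by
      refine le_trans ?_ key
      rw [add_mul]
      gcongr
      · exact min_le_left _ _
      · exact min_le_right _ _
    exact (ENNReal.mul_le_mul_iff_right hAB0 hABt).1 this
  -- Truncation at `n` makes the suprema finite and keeps the hypothesis, since `negMean` is
  -- monotone.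
  refine le_of_tendsto ((tendsto_lintegral_min_natCast volume hΦ).min
    (tendsto_lintegral_min_natCast volume hΨ)) (Filter.Eventually.of_forall fun n => ?_)
  refine bounded _ _ (hΦ.min measurable_const) (hΨ.min measurable_const) ?_ ?_ fun x y =>
    (negMean_mono one_pos (min_le_left _ _) (min_le_left _ _)).trans (hle x y)
  · exact ((iSup_le fun x => min_le_right _ _).trans_lt (ENNReal.natCast_lt_top n)).ne
  · exact ((iSup_le fun x => min_le_right _ _).trans_lt (ENNReal.natCast_lt_top n)).ne

/-! ### Comparison of power means. -/

theorem ENNReal.rpow_le_rpow_of_neg {x y : ℝ≥0∞} {r : ℝ} (hr : r < 0) (h : x ≤ y) :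
    y ^ r ≤ x ^ r := by
  have := ENNReal.rpow_le_rpow h (neg_pos.2 hr).le
  rwa [ENNReal.rpow_neg, ENNReal.rpow_neg, ENNReal.inv_le_inv] at this

theorem ENNReal.const_mul_rpow {c : ℝ≥0∞} (hc : c ≠ 0) (hc' : c ≠ ∞) (x : ℝ≥0∞) (r : ℝ) :
    (c * x) ^ r = c ^ r * x ^ r := by
  rw [ENNReal.mul_rpow_eq_ite]
  simp [hc, hc']

theorem ENNReal.geom_mean_le_arith_mean {α β : ℝ≥0} (hαβ : α + β = 1) {x y : ℝ≥0∞}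
    (hx : x ≠ ∞) (hy : y ≠ ∞) :
    x ^ (α : ℝ) * y ^ (β : ℝ) ≤ α * x + β * y := by
  lift x to ℝ≥0 using hx
  lift y to ℝ≥0 using hy
  rw [← ENNReal.coe_rpow_of_nonneg _ α.coe_nonneg, ← ENNReal.coe_rpow_of_nonneg _ β.coe_nonneg]
  exact_mod_cast NNReal.geom_mean_le_arith_mean2_weighted α β x y hαβ

section WeightedMean

variable {k : ℝ} {α β : ℝ≥0}

theorem negMean_const_mul (hk : 0 < k) (hα : α ≠ 0) (hβ : β ≠ 0) (x y : ℝ≥0∞) :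
    negMean k ((α : ℝ≥0∞) ^ (-k) * x) ((β : ℝ≥0∞) ^ (-k) * y)
      = (α * x ^ (-1 / k) + β * y ^ (-1 / k)) ^ (-k) := by
  have aux : ∀ {c : ℝ≥0} (_ : c ≠ 0) (z : ℝ≥0∞),
      ((c : ℝ≥0∞) ^ (-k) * z) ^ (-1 / k) = c * z ^ (-1 / k) := by
    intro c hc z
    have hc0 : (c : ℝ≥0∞) ≠ 0 := by simpa using hc
    rw [ENNReal.const_mul_rpow (by simp [ENNReal.rpow_eq_zero_iff, hc])
      (ENNReal.rpow_ne_top_of_ne_zero hc0 ENNReal.coe_ne_top), ← ENNReal.rpow_mul]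
    rw [show -k * (-1 / k) = 1 by field_simp, ENNReal.rpow_one]
  rw [negMean, aux hα, aux hβ]

/-- Convexity of `z ↦ z^p` with `p = -1/(ks) ≥ 1`, applied to `x^s` and `y^s`; the outer exponent
`-k` reverses the inequality. -/
theorem weighted_negMean_le_rpow_of_neg (hk : 0 < k) (hαβ : α + β = 1) {s : ℝ} (hs : s < 0)
    (hks : -1 / k ≤ s) (x y : ℝ≥0∞) :
    ((α : ℝ≥0∞) * x ^ (-1 / k) + β * y ^ (-1 / k)) ^ (-k)
      ≤ (α * x ^ s + β * y ^ s) ^ (1 / s) := by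
  have hp : 1 ≤ -1 / (k * s) := by
    rw [le_div_iff_of_neg (mul_neg_of_pos_of_neg hk hs)]
    rw [div_le_iff₀ hk] at hks
    linarith
  have e : ∀ z : ℝ≥0∞, (z ^ s) ^ (-1 / (k * s)) = z ^ (-1 / k) := fun z => by
    have := hs.ne
    rw [← ENNReal.rpow_mul]; congr 1; field_simp
  have h := ENNReal.rpow_arith_mean_le_arith_mean2_rpow α β (x ^ s) (y ^ s)
    (by exact_mod_cast hαβ) hp
  rw [e, e] at h
  refine (ENNReal.rpow_le_rpow_of_neg (neg_neg_iff_pos.2 hk) h).trans_eq ?_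
  rw [← ENNReal.rpow_mul]; congr 1; field_simp

theorem weighted_negMean_le_geom_mean (hk : 0 < k) (hαβ : α + β = 1) {x y : ℝ≥0∞}
    (hx : x ≠ 0) (hy : y ≠ 0) (hx' : x ≠ ∞) (hy' : y ≠ ∞) :
    ((α : ℝ≥0∞) * x ^ (-1 / k) + β * y ^ (-1 / k)) ^ (-k) ≤ x ^ (α : ℝ) * y ^ (β : ℝ) := by
  have h := ENNReal.geom_mean_le_arith_mean hαβ (ENNReal.rpow_ne_top_of_ne_zero hx hx' (y := -1 / k))
    (ENNReal.rpow_ne_top_of_ne_zero hy hy' (y := -1 / k))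
  refine (ENNReal.rpow_le_rpow_of_neg (neg_neg_iff_pos.2 hk) h).trans_eq ?_
  have e : ∀ (z : ℝ≥0∞) (c : ℝ), ((z ^ (-1 / k)) ^ c) ^ (-k) = z ^ c := fun z c => by
    rw [← ENNReal.rpow_mul, ← ENNReal.rpow_mul]; congr 1; field_simp
  have ne : ∀ {z : ℝ≥0∞} (c : ℝ), z ≠ 0 → z ≠ ∞ → (z ^ (-1 / k)) ^ c ≠ ∞ := fun c h h' => by
    rw [← ENNReal.rpow_mul]; exact ENNReal.rpow_ne_top_of_ne_zero h h'
  rw [ENNReal.mul_rpow_of_ne_top (ne _ hx hx') (ne _ hy hy'), e, e]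

theorem weighted_negMean_eq_zero (hk : 0 < k) (hα : α ≠ 0) (hβ : β ≠ 0) {x y : ℝ≥0∞}
    (h : x = 0 ∨ y = 0) : ((α : ℝ≥0∞) * x ^ (-1 / k) + β * y ^ (-1 / k)) ^ (-k) = 0 := by
  have e : (0 : ℝ≥0∞) ^ (-1 / k) = ∞ :=
    ENNReal.zero_rpow_of_neg (div_neg_of_neg_of_pos (by norm_num) hk)
  rcases h with rfl | rfl
  · rw [e, ENNReal.mul_top (by simpa using hα), top_add, ENNReal.top_rpow_of_neg (by linarith)]
  · rw [e, ENNReal.mul_top (by simpa using hβ), add_top, ENNReal.top_rpow_of_neg (by linarith)]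

/-- The geometric mean separates the two sides, by AM-GM for the powers `-1/k` and `s`. It is useful
only for finite nonzero arguments, so `0` and `∞` are treated apart. -/
theorem weighted_negMean_le_rpow_of_pos (hk : 0 < k) (hα : α ≠ 0) (hβ : β ≠ 0) (hαβ : α + β = 1)
    {s : ℝ} (hs : 0 < s) (x y : ℝ≥0∞) :
    ((α : ℝ≥0∞) * x ^ (-1 / k) + β * y ^ (-1 / k)) ^ (-k)
      ≤ (α * x ^ s + β * y ^ s) ^ (1 / s) := by
  by_cases h0 : x = 0 ∨ y = 0
  · rw [weighted_negMean_eq_zero hk hα hβ h0]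
    exact zero_le
  push Not at h0
  by_cases ht : x = ∞ ∨ y = ∞
  · have : (α * x ^ s + β * y ^ s) ^ (1 / s) = ∞ := by
      rcases ht with rfl | rfl
      · rw [ENNReal.top_rpow_of_pos hs, ENNReal.mul_top (by simpa using hα), top_add,
          ENNReal.top_rpow_of_pos (by positivity)]
      · rw [ENNReal.top_rpow_of_pos hs, ENNReal.mul_top (by simpa using hβ), add_top,
          ENNReal.top_rpow_of_pos (by positivity)]
    rw [this]
    exact le_top
  push Not at ht
  refine (weighted_negMean_le_geom_mean hk hαβ h0.1 h0.2 ht.1 ht.2).trans ?_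
  have h := ENNReal.geom_mean_le_arith_mean hαβ (ENNReal.rpow_ne_top_of_ne_zero h0.1 ht.1 (y := s))
    (ENNReal.rpow_ne_top_of_ne_zero h0.2 ht.2 (y := s))
  refine le_trans (le_of_eq ?_) (ENNReal.rpow_le_rpow h (one_div_pos.2 hs).le)
  rw [ENNReal.mul_rpow_of_nonneg _ _ (one_div_pos.2 hs).le]
  simp only [← ENNReal.rpow_mul]
  congr 2 <;> field_simp

/-- Weighted power means increase with the exponent, from `-1/k` to `s`; the weights `α`, `β` are
moved into the arguments. -/
theorem negMean_le_weighted_rpow (hk : 0 < k) (hα : α ≠ 0) (hβ : β ≠ 0) (hαβ : α + β = 1)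
    {s : ℝ} (hs : s ≠ 0) (hks : -1 / k ≤ s) {C D : ℝ≥0} (hC : C ≠ 0) (hD : D ≠ 0)
    (a b : ℝ≥0∞) :
    negMean k ((α : ℝ≥0∞) ^ (-k) * (((C / α : ℝ≥0) : ℝ≥0∞) ^ (1 / s) * a))
        ((β : ℝ≥0∞) ^ (-k) * (((D / β : ℝ≥0) : ℝ≥0∞) ^ (1 / s) * b))
      ≤ (C * a ^ s + D * b ^ s) ^ (1 / s) := by
  have aux : ∀ {c γ : ℝ≥0} (_ : c ≠ 0) (_ : γ ≠ 0) (z : ℝ≥0∞),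
      (γ : ℝ≥0∞) * (((c / γ : ℝ≥0) : ℝ≥0∞) ^ (1 / s) * z) ^ s = c * z ^ s := by
    intro c γ hc hγ z
    have h0 : ((c / γ : ℝ≥0) : ℝ≥0∞) ≠ 0 := by simpa using ⟨hc, hγ⟩
    rw [ENNReal.const_mul_rpow (ENNReal.rpow_pos (pos_iff_ne_zero.2 h0) ENNReal.coe_ne_top).ne'
      (ENNReal.rpow_ne_top_of_ne_zero h0 ENNReal.coe_ne_top), ← ENNReal.rpow_mul,
      one_div_mul_cancel hs, ENNReal.rpow_one, ← mul_assoc, ← ENNReal.coe_mul,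
      mul_div_cancel₀ _ hγ]
  rw [negMean_const_mul hk hα hβ, ← aux hC hα a, ← aux hD hβ b]
  rcases lt_or_gt_of_ne hs with h | h
  · exact weighted_negMean_le_rpow_of_neg hk hαβ h hks _ _
  · exact weighted_negMean_le_rpow_of_pos hk hα hβ hαβ h _ _

theorem negMean_le_max (hk : 0 < k) (hα : α ≠ 0) (hβ : β ≠ 0) (hαβ : α + β = 1)
    (a b : ℝ≥0∞) :
    negMean k ((α : ℝ≥0∞) ^ (-k) * a) ((β : ℝ≥0∞) ^ (-k) * b) ≤ max a b := by
  rw [negMean_const_mul hk hα hβ]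
  have hneg : -1 / k < 0 := div_neg_of_neg_of_pos (by norm_num) hk
  have h : (max a b) ^ (-1 / k) ≤ α * a ^ (-1 / k) + β * b ^ (-1 / k) := by
    calc (max a b) ^ (-1 / k) = ((α + β : ℝ≥0) : ℝ≥0∞) * (max a b) ^ (-1 / k) := by
          rw [hαβ]; simp
      _ = α * (max a b) ^ (-1 / k) + β * (max a b) ^ (-1 / k) := by
          rw [ENNReal.coe_add, add_mul]
      _ ≤ _ := add_le_add
          (mul_le_mul' le_rfl (ENNReal.rpow_le_rpow_of_neg hneg (le_max_left _ _)))
          (mul_le_mul' le_rfl (ENNReal.rpow_le_rpow_of_neg hneg (le_max_right _ _)))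
  refine (ENNReal.rpow_le_rpow_of_neg (neg_neg_iff_pos.2 hk) h).trans_eq ?_
  rw [← ENNReal.rpow_mul, show -1 / k * -k = 1 by field_simp, ENNReal.rpow_one]

theorem negMean_le_min (hk : 0 < k) (a b : ℝ≥0∞) : negMean k a b ≤ min a b := by
  have e : ∀ z : ℝ≥0∞, (z ^ (-1 / k)) ^ (-k) = z := fun z => by
    rw [← ENNReal.rpow_mul, show -1 / k * -k = 1 by field_simp, ENNReal.rpow_one]
  refine le_min ?_ ?_
  · refine le_trans ?_ (e a).le
    exact ENNReal.rpow_le_rpow_of_neg (neg_neg_iff_pos.2 hk) le_self_add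
  · refine le_trans ?_ (e b).le
    exact ENNReal.rpow_le_rpow_of_neg (neg_neg_iff_pos.2 hk) le_add_self

/-- Without normalised weights the order in the exponent is reversed: `z ↦ z^p` is superadditive for
`p = -s k ≥ 1`. -/
theorem negMean_le_rpow_add_rpow (hk : 0 < k) {s : ℝ} (hks : s ≤ -1 / k) (a b : ℝ≥0∞) :
    negMean k a b ≤ (a ^ s + b ^ s) ^ (1 / s) := by
  have hs : s < 0 := hks.trans_lt (div_neg_of_neg_of_pos (by norm_num) hk)
  have hp : 1 ≤ -s * k := by
    rw [le_div_iff₀ hk] at hks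
    linarith
  have e : ∀ z : ℝ≥0∞, (z ^ (-1 / k)) ^ (-s * k) = z ^ s := fun z => by
    rw [← ENNReal.rpow_mul]; congr 1; field_simp
  have h := ENNReal.add_rpow_le_rpow_add (a ^ (-1 / k)) (b ^ (-1 / k)) hp
  rw [e, e] at h
  refine le_trans (le_of_eq ?_) (ENNReal.rpow_le_rpow_of_neg (one_div_neg.2 hs) h)
  rw [negMean, ← ENNReal.rpow_mul]; congr 1
  have := hs.ne
  field_simp

end WeightedMean

/-! ### Means recovered from minima over all weights. -/

theorem tendsto_min_natCast (I : ℝ≥0∞) :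
    Filter.Tendsto (fun n : ℕ => min I n) Filter.atTop (nhds I) := by
  simpa using (tendsto_const_nhds (x := I)).min ENNReal.tendsto_nat_nhds_top

theorem exists_natCast_min_eq_coe {I : ℝ≥0∞} (hI : I ≠ 0) {n : ℕ} (hn : 1 ≤ n) :
    ∃ i : ℝ≥0, i ≠ 0 ∧ min I n = i ∧ (i : ℝ≥0∞) ≤ I := by
  have hfin : min I n ≠ ∞ := ((min_le_right _ _).trans_lt (ENNReal.natCast_lt_top n)).ne
  refine ⟨(min I n).toNNReal, ?_, (ENNReal.coe_toNNReal hfin).symm, ?_⟩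
  · rw [Ne, ENNReal.toNNReal_eq_zero_iff]
    have h0 : min I (n : ℝ≥0∞) ≠ 0 := by
      have : (0 : ℝ≥0∞) < min I n := lt_min (pos_iff_ne_zero.2 hI) (by exact_mod_cast hn)
      exact this.ne'
    tauto
  · rw [ENNReal.coe_toNNReal hfin]
    exact min_le_left _ _

theorem rpow_mean_le_of_forall_weights {C D : ℝ≥0} (hC : C ≠ 0) (hD : D ≠ 0) {γ : ℝ}
    (hγ : γ ≠ 0) {I J X : ℝ≥0∞} (hI : I ≠ 0) (hJ : J ≠ 0)
    (h : ∀ α β : ℝ≥0, α ≠ 0 → β ≠ 0 → α + β = 1 →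
      min (((C / α : ℝ≥0) : ℝ≥0∞) ^ (1 / γ) * I) (((D / β : ℝ≥0) : ℝ≥0∞) ^ (1 / γ) * J) ≤ X) :
    (C * I ^ γ + D * J ^ γ) ^ (1 / γ) ≤ X := by
  have finite : ∀ i j : ℝ≥0, i ≠ 0 → j ≠ 0 → (i : ℝ≥0∞) ≤ I → (j : ℝ≥0∞) ≤ J →
      ((C : ℝ≥0∞) * (i : ℝ≥0∞) ^ γ + D * (j : ℝ≥0∞) ^ γ) ^ (1 / γ) ≤ X := by
    intro i j hi hj hiI hjJ
    set a := i ^ γ with ha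
    set b := j ^ γ with hb
    have ha0 : a ≠ 0 := (NNReal.rpow_pos (pos_iff_ne_zero.2 hi)).ne'
    have hb0 : b ≠ 0 := (NNReal.rpow_pos (pos_iff_ne_zero.2 hj)).ne'
    set S := C * a + D * b with hS
    have hS0 : S ≠ 0 := by positivity
    have e1 : (C / (C * a / S)) ^ (1 / γ) * i = S ^ (1 / γ) := by
      rw [show C / (C * a / S) = S / a by field_simp, NNReal.div_rpow, ha, ← NNReal.rpow_mul,
        mul_one_div_cancel hγ, NNReal.rpow_one, div_mul_cancel₀ _ hi]
    have e2 : (D / (D * b / S)) ^ (1 / γ) * j = S ^ (1 / γ) := by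
      rw [show D / (D * b / S) = S / b by field_simp, NNReal.div_rpow, hb, ← NNReal.rpow_mul,
        mul_one_div_cancel hγ, NNReal.rpow_one, div_mul_cancel₀ _ hj]
    have e3 : ((C : ℝ≥0∞) * (i : ℝ≥0∞) ^ γ + D * (j : ℝ≥0∞) ^ γ) ^ (1 / γ)
        = ((S ^ (1 / γ) : ℝ≥0) : ℝ≥0∞) := by
      rw [← ENNReal.coe_rpow_of_ne_zero hi, ← ENNReal.coe_rpow_of_ne_zero hj,
        ENNReal.coe_rpow_of_ne_zero hS0]
      rfl
    rw [e3]
    -- These weights equalise the two terms of the minimum: both become `S ^ (1 / γ)`, up to `i ≤ I`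
    -- and `j ≤ J`.
    refine le_trans (le_min ?_ ?_) (h (C * a / S) (D * b / S) (by positivity) (by positivity)
      (by rw [← add_div, ← hS, div_self hS0]))
    · rw [← e1, ENNReal.coe_mul, ENNReal.coe_rpow_of_ne_zero (by positivity)]
      gcongr
    · rw [← e2, ENNReal.coe_mul, ENNReal.coe_rpow_of_ne_zero (by positivity)]
      gcongr
  have lim : Filter.Tendsto (fun n : ℕ => ((C : ℝ≥0∞) * (min I n) ^ γ + D * (min J n) ^ γ) ^ (1 / γ))
      Filter.atTop (nhds ((C * I ^ γ + D * J ^ γ) ^ (1 / γ))) := by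
    have aux : ∀ (K : ℝ≥0∞) (c : ℝ≥0), Filter.Tendsto (fun n : ℕ => (c : ℝ≥0∞) * (min K n) ^ γ)
        Filter.atTop (nhds (c * K ^ γ)) := fun K c =>
      ENNReal.Tendsto.const_mul ((ENNReal.continuous_rpow_const.tendsto K).comp
        (tendsto_min_natCast K)) (Or.inr ENNReal.coe_ne_top)
    exact (ENNReal.continuous_rpow_const.tendsto _).comp ((aux I C).add (aux J D))
  refine le_of_tendsto lim (Filter.eventually_atTop.2 ⟨1, fun n hn => ?_⟩)
  obtain ⟨i, hi, ei, hiI⟩ := exists_natCast_min_eq_coe hI hn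
  obtain ⟨j, hj, ej, hjJ⟩ := exists_natCast_min_eq_coe hJ hn
  rw [ei, ej]
  exact finite i j hi hj hiI hjJ

theorem geom_mean_le_of_forall_coe {C D : ℝ≥0} {I J X : ℝ≥0∞} (hI : I ≠ 0) (hJ : J ≠ 0)
    (h : ∀ i j : ℝ≥0, i ≠ 0 → j ≠ 0 → (i : ℝ≥0∞) ≤ I → (j : ℝ≥0∞) ≤ J →
      (i : ℝ≥0∞) ^ (C : ℝ) * (j : ℝ≥0∞) ^ (D : ℝ) ≤ X) :
    I ^ (C : ℝ) * J ^ (D : ℝ) ≤ X := by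
  have aux : ∀ (K : ℝ≥0∞) (c : ℝ≥0), Filter.Tendsto (fun n : ℕ => (min K n) ^ (c : ℝ))
      Filter.atTop (nhds (K ^ (c : ℝ))) := fun K c =>
    (ENNReal.continuous_rpow_const.tendsto K).comp (tendsto_min_natCast K)
  have hne : ∀ {K : ℝ≥0∞} {c : ℝ≥0}, K ≠ 0 → K ^ (c : ℝ) ≠ 0 := fun {K c} hK => by
    simp [ENNReal.rpow_eq_zero_iff, hK]
  refine le_of_tendsto (ENNReal.Tendsto.mul (aux I C) (Or.inl (hne hI)) (aux J D)
    (Or.inl (hne hJ))) (Filter.eventually_atTop.2 ⟨1, fun n hn => ?_⟩)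
  obtain ⟨i, hi, ei, hiI⟩ := exists_natCast_min_eq_coe hI hn
  obtain ⟨j, hj, ej, hjJ⟩ := exists_natCast_min_eq_coe hJ hn
  rw [ei, ej]
  exact h i j hi hj hiI hjJ

/-! ### The scale-invariant inequality in dimension `k`. -/

/-- The scale-invariant form of the Borell–Brascamp–Lieb inequality in dimension `k`, for a
measure `μ` on an additive group: the exponent `-1/k` of the means of the densities is the one for
which the mean of the masses is their minimum. -/
def NegMeanInequality {E : Type*} [Add E] [MeasurableSpace E] (μ : Measure E) (k : ℝ) : Prop :=
  ∀ Φ Ψ h : E → ℝ≥0∞, Measurable Φ → Measurable Ψ → Measurable h →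
    (∀ u v, negMean k (Φ u) (Ψ v) ≤ h (u + v)) →
    min (∫⁻ u, Φ u ∂μ) (∫⁻ v, Ψ v ∂μ) ≤ ∫⁻ w, h w ∂μ

theorem NegMeanInequality.of_measurePreserving {E F : Type*} [Add E] [Add F]
    [MeasurableSpace E] [MeasurableSpace F] {μ : Measure E} {ν : Measure F} {k : ℝ} (e : E ≃ᵐ F)
    (he : MeasurePreserving e μ ν) (hadd : ∀ u v, e (u + v) = e u + e v)
    (h : NegMeanInequality μ k) : NegMeanInequality ν k := by
  intro Φ Ψ g hΦ hΨ hg hle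
  rw [← he.lintegral_comp hΦ, ← he.lintegral_comp hΨ, ← he.lintegral_comp hg]
  refine h _ _ _ (hΦ.comp e.measurable) (hΨ.comp e.measurable) (hg.comp e.measurable) fun u v => ?_
  simpa only [hadd] using hle (e u) (e v)

theorem negMeanInequality_real : NegMeanInequality (volume : Measure ℝ) 1 :=
  fun _ _ _ hΦ hΨ hh hle => min_lintegral_le_of_negMean_one_le hΦ hΨ hh hle

theorem negMean_mul_le_negMean_add_one {m : ℝ} (hm : 0 < m) {α β : ℝ≥0} (hα : α ≠ 0)
    (hβ : β ≠ 0) (hαβ : α + β = 1) (a b : ℝ≥0∞) :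
    negMean m (α * a) (β * b) ≤ negMean (m + 1) a b := by
  have key := negMean_le_weighted_rpow hm hα hβ hαβ (s := -1 / (m + 1))
    (div_ne_zero (by norm_num) (by positivity))
    (by rw [neg_div, neg_div, neg_le_neg_iff]; gcongr; linarith) one_ne_zero one_ne_zero a b
  have e : ∀ {c : ℝ≥0} (_ : c ≠ 0) (z : ℝ≥0∞), (c : ℝ≥0∞) ^ (-m) *
      (((1 / c : ℝ≥0) : ℝ≥0∞) ^ (1 / (-1 / (m + 1))) * z) = c * z := by
    intro c hc z
    rw [← mul_assoc]
    congr 1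
    rw [one_div c, ENNReal.coe_inv hc, ENNReal.inv_rpow, ← ENNReal.rpow_neg,
      ← ENNReal.rpow_add _ _ (by simpa using hc) ENNReal.coe_ne_top]
    rw [show -m + -(1 / (-1 / (m + 1))) = 1 by field_simp; ring, ENNReal.rpow_one]
  rw [e hα, e hβ, show 1 / (-1 / (m + 1)) = -(m + 1) by field_simp] at key
  simpa only [negMean, ENNReal.coe_one, one_mul] using key

/-- On the fibres over `x` and `y`, scaling the functions by `α` and `β` gives `min (α I) (β J) ≤ ∫
g (x + y, ·)` whenever `α + β = 1`. The optimal weights give the harmonic expression `negMean 1 I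
J`, exactly the hypothesis of the inequality on the line. -/
theorem NegMeanInequality.prod_real {E : Type*} [Add E] [MeasurableSpace E] {μ : Measure E}
    [SFinite μ] {m : ℝ} (hm : 0 < m) (h : NegMeanInequality μ m) :
    NegMeanInequality ((volume : Measure ℝ).prod μ) (m + 1) := by
  intro Φ Ψ g hΦ hΨ hg hle
  rw [lintegral_prod _ hΦ.aemeasurable, lintegral_prod _ hΨ.aemeasurable,
    lintegral_prod _ hg.aemeasurable]
  refine min_lintegral_le_of_negMean_one_le hΦ.lintegral_prod_right' hΨ.lintegral_prod_right'
    hg.lintegral_prod_right' fun x y => ?_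
  set I := ∫⁻ u, Φ (x, u) ∂μ with hI
  set J := ∫⁻ v, Ψ (y, v) ∂μ with hJ
  by_cases h0 : I = 0 ∨ J = 0
  · have : negMean 1 I J = 0 := by rw [negMean_one]; rcases h0 with h0 | h0 <;> simp [h0]
    rw [this]
    exact zero_le
  push Not at h0
  have key := rpow_mean_le_of_forall_weights (C := 1) (D := 1) one_ne_zero one_ne_zero (γ := -1)
    (by norm_num) h0.1 h0.2 (X := ∫⁻ w, g (x + y, w) ∂μ) ?_
  · simpa [negMean_one, ENNReal.rpow_neg_one] using key
  intro α β hα hβ hαβ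
  have e : ∀ {c : ℝ≥0} (_ : c ≠ 0), ((1 / c : ℝ≥0) : ℝ≥0∞) ^ (1 / (-1) : ℝ) = c := by
    intro c hc
    rw [one_div c, ENNReal.coe_inv hc, show (1 / (-1) : ℝ) = -1 by norm_num,
      ENNReal.rpow_neg_one, inv_inv]
  rw [e hα, e hβ]
  have hΦx : Measurable fun u => Φ (x, u) := hΦ.comp measurable_prodMk_left
  have hΨy : Measurable fun v => Ψ (y, v) := hΨ.comp measurable_prodMk_left
  have := h (fun u => α * Φ (x, u)) (fun v => β * Ψ (y, v)) (fun w => g (x + y, w))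
    (hΦx.const_mul _) (hΨy.const_mul _) (hg.comp measurable_prodMk_left) fun u v =>
      (negMean_mul_le_negMean_add_one hm hα hβ hαβ _ _).trans (hle (x, u) (y, v))
  rwa [lintegral_const_mul _ hΦx, lintegral_const_mul _ hΨy] at this

theorem negMeanInequality_pi (m : ℕ) :
    NegMeanInequality (volume : Measure (Fin (m + 1) → ℝ)) ((m + 1 : ℕ) : ℝ) := by
  induction m with
  | zero =>
    have := negMeanInequality_real.of_measurePreserving (MeasurableEquiv.funUnique (Fin 1) ℝ).symm
      (volume_preserving_funUnique (Fin 1) ℝ).symm (fun u v => rfl)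
    rw [zero_add, Nat.cast_one]
    exact this
  | succ m ih =>
    have h := ih.prod_real (by positivity)
    have := h.of_measurePreserving (MeasurableEquiv.piFinSuccAbove (fun _ => ℝ) 0).symm
      (volume_preserving_piFinSuccAbove (fun _ : Fin (m + 1 + 1) => ℝ) 0).symm ?_
    · rw [Nat.cast_succ (m + 1)]
      exact this
    · intro u v
      ext i
      refine Fin.cases ?_ (fun i => ?_) i <;> simp [MeasurableEquiv.piFinSuccAbove]

theorem negMeanInequality_volume {E : Type*} [NormedAddCommGroup E] [InnerProductSpace ℝ E]
    [FiniteDimensional ℝ E] [MeasurableSpace E] [BorelSpace E] (hE : 0 < Module.finrank ℝ E) :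
    NegMeanInequality (volume : Measure E) (Module.finrank ℝ E) := by
  obtain ⟨m, hm⟩ := Nat.exists_eq_succ_of_ne_zero hE.ne'
  have h1 := (negMeanInequality_pi m).of_measurePreserving (MeasurableEquiv.toLp 2 _)
    (EuclideanSpace.volume_preserving_symm_measurableEquiv_toLp (Fin (m + 1))).symm (fun u v => rfl)
  let f : EuclideanSpace ℝ (Fin (m + 1)) ≃ₗᵢ[ℝ] E := ((stdOrthonormalBasis ℝ E).reindex
    (finCongr hm)).repr.symm
  rw [hm]
  exact h1.of_measurePreserving f.toMeasurableEquiv f.measurePreserving (map_add f)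

/-! ### The means `sMean` and the exponent `γ`. -/

theorem sMean_eq_zero {s : EReal} {α β : ℝ} {a b : ℝ≥0∞} (h : a = 0 ∨ b = 0) :
    sMean s α β a b = 0 := by
  rw [sMean, if_pos h]

theorem sMean_comm (s : EReal) (α β : ℝ) (a b : ℝ≥0∞) : sMean s α β a b = sMean s β α b a := by
  simp only [sMean, or_comm (a := a = 0), max_comm a, min_comm a, mul_comm (a ^ α),
    add_comm (ENNReal.ofReal α * _)]

theorem sMean_coe {s : ℝ} (hs : s ≠ 0) (C D : ℝ≥0) {a b : ℝ≥0∞} (ha : a ≠ 0) (hb : b ≠ 0) :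
    sMean (s : EReal) C D a b = (C * a ^ s + D * b ^ s) ^ (1 / s) := by
  simp [sMean, ha, hb, hs]

theorem sMean_top (α β : ℝ) {a b : ℝ≥0∞} (ha : a ≠ 0) (hb : b ≠ 0) :
    sMean ⊤ α β a b = max a b := by
  simp [sMean, ha, hb]

theorem sMean_bot (α β : ℝ) {a b : ℝ≥0∞} (ha : a ≠ 0) (hb : b ≠ 0) :
    sMean ⊥ α β a b = min a b := by
  simp [sMean, ha, hb]

theorem sMean_zero (α β : ℝ) {a b : ℝ≥0∞} (ha : a ≠ 0) (hb : b ≠ 0) :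
    sMean 0 α β a b = a ^ α * b ^ β := by
  simp [sMean, ha, hb]

/-- The exponent satisfies `1/γ = k + 1/s`, also at `s = ±∞`, where `s.toReal = 0`. -/
theorem brunnExponent_eq_coe {k : ℕ} (hk : 0 < k) {s : EReal} (hs : s ≠ 0)
    (h : s = ⊤ ∨ s = ⊥ ∨ 1 + (k : ℝ) * s.toReal ≠ 0) :
    ∃ γ : ℝ, γ ≠ 0 ∧ brunnExponent k s = (γ : EReal) ∧ 1 / γ = k + 1 / s.toReal := by
  have hk' : (k : ℝ) ≠ 0 := by positivity
  by_cases ht : s = ⊤ ∨ s = ⊥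
  · refine ⟨1 / k, by positivity, by rw [brunnExponent, if_pos ht], ?_⟩
    rcases ht with rfl | rfl <;> simp
  · have h1 : 1 + (k : ℝ) * s.toReal ≠ 0 := by tauto
    push Not at ht
    have hs' : s.toReal ≠ 0 := by
      rw [Ne, EReal.toReal_eq_zero_iff]
      tauto
    refine ⟨s.toReal / (1 + k * s.toReal), div_ne_zero hs' h1, ?_, ?_⟩
    · rw [brunnExponent, if_neg (by tauto), if_neg h1]
    · field_simp
      ring

theorem brunnExponent_eq_bot {k : ℕ} {s : ℝ} (h : 1 + (k : ℝ) * s = 0) :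
    brunnExponent k s = ⊥ := by
  simp [brunnExponent, h]

theorem negMean_le_sMean {k : ℝ} (hk : 0 < k) {α β C D : ℝ≥0} (hα : α ≠ 0) (hβ : β ≠ 0)
    (hαβ : α + β = 1) (hC : C ≠ 0) (hD : D ≠ 0) {s : EReal} (hs : s ≠ 0)
    (hks : ((-1 / k : ℝ) : EReal) ≤ s) (a b : ℝ≥0∞) :
    negMean k ((α : ℝ≥0∞) ^ (-k) * (((C / α : ℝ≥0) : ℝ≥0∞) ^ (1 / s.toReal)) * a)
      ((β : ℝ≥0∞) ^ (-k) * (((D / β : ℝ≥0) : ℝ≥0∞) ^ (1 / s.toReal)) * b) ≤ sMean s C D a b := by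
  by_cases h0 : a = 0 ∨ b = 0
  · rw [sMean_eq_zero h0]
    refine (negMean_le_min hk _ _).trans ?_
    rcases h0 with rfl | rfl <;> simp
  push Not at h0
  rw [mul_assoc, mul_assoc]
  induction s with
  | bot => exact absurd hks (by simp)
  | top =>
    rw [sMean_top _ _ h0.1 h0.2]
    -- Here `s.toReal = 0`, so the exponent `1 / s.toReal` is `0` and the factors `C / α`, `D / β`
    -- disappear.
    simpa using negMean_le_max hk hα hβ hαβ a b
  | coe s =>
    have hs' : s ≠ 0 := by exact_mod_cast hs
    rw [sMean_coe hs' _ _ h0.1 h0.2]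
    exact negMean_le_weighted_rpow hk hα hβ hαβ hs' (by exact_mod_cast hks) hC hD a b

theorem negMean_le_sMean_of_le {k : ℝ} (hk : 0 < k) {C D : ℝ≥0} (hC : C ≠ 0) (hD : D ≠ 0)
    {s : EReal} (hks : s ≤ ((-1 / k : ℝ) : EReal)) (a b : ℝ≥0∞) :
    negMean k ((C : ℝ≥0∞) ^ (1 / s.toReal) * a) ((D : ℝ≥0∞) ^ (1 / s.toReal) * b)
      ≤ sMean s C D a b := by
  by_cases h0 : a = 0 ∨ b = 0
  · rw [sMean_eq_zero h0]
    refine (negMean_le_min hk _ _).trans ?_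
    rcases h0 with rfl | rfl <;> simp
  push Not at h0
  induction s with
  | bot =>
    rw [sMean_bot _ _ h0.1 h0.2]
    simpa using negMean_le_min hk a b
  | top => exact absurd hks (by simp)
  | coe s =>
    have hks' : s ≤ -1 / k := by exact_mod_cast hks
    have hs : s ≠ 0 := (hks'.trans_lt (div_neg_of_neg_of_pos (by norm_num) hk)).ne
    have e : ∀ {c : ℝ≥0} (_ : c ≠ 0) (z : ℝ≥0∞), ((c : ℝ≥0∞) ^ (1 / s) * z) ^ s = c * z ^ s := by
      intro c hc z
      have h0 : (c : ℝ≥0∞) ≠ 0 := by simpa using hc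
      rw [ENNReal.const_mul_rpow (ENNReal.rpow_pos (pos_iff_ne_zero.2 h0) ENNReal.coe_ne_top).ne'
        (ENNReal.rpow_ne_top_of_ne_zero h0 ENNReal.coe_ne_top), ← ENNReal.rpow_mul,
        one_div_mul_cancel hs, ENNReal.rpow_one]
    rw [sMean_coe hs _ _ h0.1 h0.2, ← e hC, ← e hD]
    exact negMean_le_rpow_add_rpow hk hks' _ _

/-! ### Integral inequalities with weights `C` and `D`. -/

section Integral

variable {E : Type*} [NormedAddCommGroup E] [InnerProductSpace ℝ E] [FiniteDimensional ℝ E]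
  [MeasurableSpace E] [BorelSpace E]

theorem lintegral_comp_inv_smul {C : ℝ≥0} (hC : C ≠ 0) {F : E → ℝ≥0∞} (hF : Measurable F) :
    ∫⁻ u, F ((C : ℝ)⁻¹ • u) = (C : ℝ≥0∞) ^ (Module.finrank ℝ E : ℝ) * ∫⁻ u, F u := by
  have hC' : (C : ℝ) ≠ 0 := by exact_mod_cast hC
  have h := Measure.map_addHaar_smul (volume : Measure E) (inv_ne_zero hC')
  rw [← lintegral_map (μ := volume) (g := fun u : E => (C : ℝ)⁻¹ • u) hF (measurable_const_smul _),
    h, lintegral_smul_measure, smul_eq_mul]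
  congr 1
  rw [inv_pow, inv_inv, abs_of_nonneg (by positivity), ENNReal.rpow_natCast,
    ENNReal.ofReal_pow C.coe_nonneg, ENNReal.ofReal_coe_nnreal]

variable {C D : ℝ≥0} {F G h : E → ℝ≥0∞}

/-- Dilating `F` by `C` and `G` by `D` reduces to the unweighted sum `u + v`; the Jacobians supply
the powers `C^k` and `D^k`. -/
theorem min_lintegral_le_of_negMean_le (hE : 0 < Module.finrank ℝ E) (hC : C ≠ 0) (hD : D ≠ 0)
    (hF : Measurable F) (hG : Measurable G) (hh : Measurable h) (ρ τ : ℝ≥0∞)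
    (hle : ∀ u v, negMean (Module.finrank ℝ E) (ρ * F u) (τ * G v) ≤ h ((C : ℝ) • u + (D : ℝ) • v)) :
    min ((C : ℝ≥0∞) ^ (Module.finrank ℝ E : ℝ) * ρ * ∫⁻ u, F u)
      ((D : ℝ≥0∞) ^ (Module.finrank ℝ E : ℝ) * τ * ∫⁻ v, G v) ≤ ∫⁻ w, h w := by
  have hC' : (C : ℝ) ≠ 0 := by exact_mod_cast hC
  have hD' : (D : ℝ) ≠ 0 := by exact_mod_cast hD
  have key := negMeanInequality_volume hE (fun u => ρ * F ((C : ℝ)⁻¹ • u))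
    (fun v => τ * G ((D : ℝ)⁻¹ • v)) h
    ((hF.comp (measurable_const_smul _)).const_mul _)
    ((hG.comp (measurable_const_smul _)).const_mul _) hh fun u v => by
      simpa [smul_smul, hC', hD'] using hle ((C : ℝ)⁻¹ • u) ((D : ℝ)⁻¹ • v)
  rw [lintegral_comp_inv_smul hC (hF.const_mul ρ), lintegral_comp_inv_smul hD (hG.const_mul τ),
    lintegral_const_mul _ hF, lintegral_const_mul _ hG] at key
  simpa only [mul_assoc] using key

/-- The case `C = 0`, in which only the values of `G` matter. -/
theorem lintegral_le_of_sMean_le_of_left_eq_zero (hD : D ≠ 0) {s : EReal} (hs : s ≠ 0)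
    (hs' : s ≠ ⊥) (hF0 : ∫⁻ u, F u ≠ 0) (hG : Measurable G)
    (hle : ∀ u v, sMean s (0 : ℝ≥0) D (F u) (G v) ≤ h (((0 : ℝ≥0) : ℝ) • u + (D : ℝ) • v)) :
    (D : ℝ≥0∞) ^ (Module.finrank ℝ E + 1 / s.toReal) * ∫⁻ v, G v ≤ ∫⁻ w, h w := by
  have hD' : (D : ℝ) ≠ 0 := by exact_mod_cast hD
  have hD0 : (D : ℝ≥0∞) ≠ 0 := by simpa using hD
  obtain ⟨u, hu⟩ : ∃ u, F u ≠ 0 := by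
    by_contra! h0
    exact hF0 (by simp [h0])
  have hpt : ∀ v, (D : ℝ≥0∞) ^ (1 / s.toReal) * G ((D : ℝ)⁻¹ • v) ≤ h v := by
    intro v
    have := hle u ((D : ℝ)⁻¹ • v)
    rw [NNReal.coe_zero, zero_smul, zero_add, smul_smul, mul_inv_cancel₀ hD', one_smul] at this
    refine le_trans ?_ this
    by_cases h0 : G ((D : ℝ)⁻¹ • v) = 0
    · simp [h0]
    induction s with
    | bot => exact absurd rfl hs'
    | top =>
      rw [sMean_top _ _ hu h0]
      simp
    | coe s =>
      have hs0 : s ≠ 0 := by exact_mod_cast hs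
      have := sMean_coe hs0 0 D hu h0
      rw [NNReal.coe_zero] at this
      rw [this, ENNReal.coe_zero, zero_mul, zero_add, ENNReal.const_mul_rpow hD0 ENNReal.coe_ne_top,
        ← ENNReal.rpow_mul, mul_one_div_cancel hs0, ENNReal.rpow_one, EReal.toReal_coe]
  refine le_trans (le_of_eq ?_) (lintegral_mono hpt)
  have hG' : Measurable fun v => G ((D : ℝ)⁻¹ • v) := hG.comp (measurable_const_smul _)
  rw [lintegral_const_mul _ hG', lintegral_comp_inv_smul hD hG,
    ← mul_assoc, ← ENNReal.rpow_add _ _ hD0 ENNReal.coe_ne_top, add_comm]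

theorem sMean_brunnExponent_zero_left_le {k : ℕ} (hk : 0 < k) {s : EReal} (hs : s ≠ 0)
    (hs' : s ≠ ⊥) (hD : D ≠ 0) {I J : ℝ≥0∞} (hI : I ≠ 0) (hJ : J ≠ 0) :
    sMean (brunnExponent k s) (0 : ℝ≥0) D I J ≤ (D : ℝ≥0∞) ^ (k + 1 / s.toReal) * J := by
  have hD0 : (D : ℝ≥0∞) ≠ 0 := by simpa using hD
  by_cases h : s = ⊤ ∨ s = ⊥ ∨ 1 + (k : ℝ) * s.toReal ≠ 0
  · obtain ⟨γ, hγ, e1, e2⟩ := brunnExponent_eq_coe hk hs h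
    rw [e1, sMean_coe hγ _ _ hI hJ, ← e2, ENNReal.coe_zero, zero_mul, zero_add,
      ENNReal.const_mul_rpow hD0 ENNReal.coe_ne_top, ← ENNReal.rpow_mul, mul_one_div_cancel hγ,
      ENNReal.rpow_one]
  · push Not at h
    lift s to ℝ using ⟨h.1, h.2.1⟩
    rw [EReal.toReal_coe] at *
    have hs0 : s ≠ 0 := by exact_mod_cast hs
    rw [brunnExponent_eq_bot h.2.2, sMean_bot _ _ hI hJ]
    have : (k : ℝ) + 1 / s = 0 := by
      field_simp
      linarith [h.2.2]
    rw [this, ENNReal.rpow_zero, one_mul]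
    exact min_le_right _ _

/-- The Borell–Brascamp–Lieb inequality for weights `C`, `D` of arbitrary sum and `s ≥ -1/k`. -/
theorem sMean_lintegral_le (hE : 0 < Module.finrank ℝ E) (hCD : C ≠ 0 ∨ D ≠ 0) {s : EReal}
    (hs : s ≠ 0) (hks : ((-1 / (Module.finrank ℝ E : ℝ) : ℝ) : EReal) ≤ s)
    (hF : Measurable F) (hG : Measurable G) (hh : Measurable h)
    (hle : ∀ u v, sMean s C D (F u) (G v) ≤ h ((C : ℝ) • u + (D : ℝ) • v)) :
    sMean (brunnExponent (Module.finrank ℝ E) s) C D (∫⁻ u, F u) (∫⁻ v, G v) ≤ ∫⁻ w, h w := by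
  have hbot : s ≠ ⊥ := by
    rintro rfl
    exact absurd hks (by simp)
  set k := Module.finrank ℝ E with hkdef
  by_cases h0 : ∫⁻ u, F u = 0 ∨ ∫⁻ v, G v = 0
  · rw [sMean_eq_zero h0]
    exact zero_le
  push Not at h0
  by_cases hC : C = 0
  · subst hC
    have hD : D ≠ 0 := by tauto
    exact (sMean_brunnExponent_zero_left_le hE hs hbot hD h0.1 h0.2).trans
      (lintegral_le_of_sMean_le_of_left_eq_zero hD hs hbot h0.1 hG hle)
  by_cases hD : D = 0
  · subst hD
    rw [sMean_comm]
    refine (sMean_brunnExponent_zero_left_le hE hs hbot hC h0.2 h0.1).trans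
      (lintegral_le_of_sMean_le_of_left_eq_zero hC hs hbot h0.2 hF fun u v => ?_)
    rw [sMean_comm, add_comm]
    exact hle v u
  have hk : (0 : ℝ) < k := by exact_mod_cast hE
  have key : ∀ α β : ℝ≥0, α ≠ 0 → β ≠ 0 → α + β = 1 →
      min (((C / α : ℝ≥0) : ℝ≥0∞) ^ (k + 1 / s.toReal) * ∫⁻ u, F u)
        (((D / β : ℝ≥0) : ℝ≥0∞) ^ (k + 1 / s.toReal) * ∫⁻ v, G v) ≤ ∫⁻ w, h w := by
    intro α β hα hβ hαβ
    have := min_lintegral_le_of_negMean_le hE hC hD hF hG hh _ _ fun u v =>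
      (negMean_le_sMean hk hα hβ hαβ hC hD hs hks (F u) (G v)).trans (hle u v)
    have e : ∀ {c γ : ℝ≥0} (_ : c ≠ 0) (_ : γ ≠ 0), (c : ℝ≥0∞) ^ (k : ℝ) *
        ((γ : ℝ≥0∞) ^ (-(k : ℝ)) * ((c / γ : ℝ≥0) : ℝ≥0∞) ^ (1 / s.toReal))
        = ((c / γ : ℝ≥0) : ℝ≥0∞) ^ (k + 1 / s.toReal) := by
      intro c γ hc hγ
      rw [ENNReal.rpow_add _ _ (by simpa using ⟨hc, hγ⟩) ENNReal.coe_ne_top, ← mul_assoc,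
        ENNReal.coe_div hγ, div_eq_mul_inv (c : ℝ≥0∞), ENNReal.mul_rpow_of_nonneg _ _ hk.le,
        ENNReal.inv_rpow, ENNReal.rpow_neg]
    rwa [e hC hα, e hD hβ] at this
  by_cases hγ : s = ⊤ ∨ s = ⊥ ∨ 1 + (k : ℝ) * s.toReal ≠ 0
  · obtain ⟨γ, hγ, e1, e2⟩ := brunnExponent_eq_coe hE hs hγ
    rw [e1, sMean_coe hγ _ _ h0.1 h0.2]
    rw [← e2] at key
    exact rpow_mean_le_of_forall_weights hC hD hγ h0.1 h0.2 key
  · push Not at hγ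
    lift s to ℝ using ⟨hγ.1, hγ.2.1⟩
    rw [EReal.toReal_coe] at *
    have hs0 : s ≠ 0 := by exact_mod_cast hs
    rw [brunnExponent_eq_bot hγ.2.2, sMean_bot _ _ h0.1 h0.2]
    have e : (k : ℝ) + 1 / s = 0 := by
      field_simp
      linarith [hγ.2.2]
    -- At `s = -1/k` the exponent `k + 1/s` vanishes, so the bound is the plain minimum for any
    -- choice of weights.
    simpa only [e, ENNReal.rpow_zero, one_mul] using
      key (1 / 2) (1 / 2) (by simp) (by simp) (add_halves 1)

theorem quasi_lintegral_le (hE : 0 < Module.finrank ℝ E) {s : EReal}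
    (hks : s < ((-1 / (Module.finrank ℝ E : ℝ) : ℝ) : EReal))
    (hF : Measurable F) (hG : Measurable G) (hh : Measurable h)
    (hle : C ≠ 0 → D ≠ 0 → ∀ u v, sMean s C D (F u) (G v) ≤ h ((C : ℝ) • u + (D : ℝ) • v)) :
    min ((C : ℝ≥0∞) ^ (1 / (brunnExponent (Module.finrank ℝ E) s).toReal) * ∫⁻ u, F u)
      ((D : ℝ≥0∞) ^ (1 / (brunnExponent (Module.finrank ℝ E) s).toReal) * ∫⁻ v, G v)
      ≤ ∫⁻ w, h w := by
  set k := Module.finrank ℝ E with hkdef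
  have hk : (0 : ℝ) < k := by exact_mod_cast hE
  have hs0 : s < 0 := hks.trans (EReal.coe_neg'.2 (div_neg_of_neg_of_pos (by norm_num) hk))
  have hreal : ∀ s' : ℝ, s = s' → 1 + (k : ℝ) * s' < 0 := by
    rintro s' rfl
    have : s' < -1 / k := by exact_mod_cast hks
    rw [lt_div_iff₀ hk] at this
    linarith
  have hpos : 0 < k + 1 / s.toReal := by
    induction s with
    | bot => simpa using hk
    | top => exact absurd hs0 (by simp)
    | coe s =>
      have h1 := hreal s rfl
      have h2 : s < 0 := by exact_mod_cast hs0
      rw [EReal.toReal_coe, show (k : ℝ) + 1 / s = (1 + k * s) / s by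
        have := h2.ne
        field_simp
        ring]
      exact div_pos_of_neg_of_neg h1 h2
  obtain ⟨γ, hγ, e1, e2⟩ := brunnExponent_eq_coe hE hs0.ne (s := s) (by
    induction s with
    | bot => simp
    | top => simp
    | coe s => exact Or.inr (Or.inr (by simpa using (hreal s rfl).ne)))
  rw [e1, EReal.toReal_coe, e2]
  -- As `1/γ > 0`, a zero coefficient kills the minimum; so `hle` is needed only for nonzero `C` and
  -- `D`.
  by_cases hC : C = 0
  · simp [hC, ENNReal.zero_rpow_of_pos (by simpa using hpos)]
  by_cases hD : D = 0
  · simp [hD, ENNReal.zero_rpow_of_pos (by simpa using hpos)]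
  have := min_lintegral_le_of_negMean_le hE hC hD hF hG hh _ _ fun u v =>
    (negMean_le_sMean_of_le hk hC hD hks.le (F u) (G v)).trans (hle hC hD u v)
  rwa [← ENNReal.rpow_add _ _ (by simpa using hC) ENNReal.coe_ne_top,
    ← ENNReal.rpow_add _ _ (by simpa using hD) ENNReal.coe_ne_top] at this

/-- The Prékopa–Leindler inequality. -/
theorem prekopa_leindler (hE : 0 < Module.finrank ℝ E) (hCD : C + D = 1)
    (hF : Measurable F) (hG : Measurable G) (hh : Measurable h)
    (hF' : ∀ u, F u ≠ ∞) (hG' : ∀ u, G u ≠ ∞)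
    (hle : ∀ u v, sMean 0 C D (F u) (G v) ≤ h ((C : ℝ) • u + (D : ℝ) • v)) :
    sMean 0 C D (∫⁻ u, F u) (∫⁻ v, G v) ≤ ∫⁻ w, h w := by
  have hk : (0 : ℝ) < Module.finrank ℝ E := by exact_mod_cast hE
  by_cases h0 : ∫⁻ u, F u = 0 ∨ ∫⁻ v, G v = 0
  · rw [sMean_eq_zero h0]
    exact zero_le
  push Not at h0
  rw [sMean_zero _ _ h0.1 h0.2]
  obtain ⟨u₀, hu₀⟩ : ∃ u, F u ≠ 0 := by
    by_contra! h'
    exact h0.1 (by simp [h'])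
  obtain ⟨v₀, hv₀⟩ : ∃ v, G v ≠ 0 := by
    by_contra! h'
    exact h0.2 (by simp [h'])
  by_cases hC : C = 0
  · obtain rfl : D = 1 := by simpa [hC] using hCD
    subst hC
    simp only [NNReal.coe_zero, NNReal.coe_one, ENNReal.rpow_zero, ENNReal.rpow_one, one_mul]
    refine lintegral_mono fun v => ?_
    by_cases hv : G v = 0
    · simp [hv]
    · simpa [sMean_zero _ _ hu₀ hv] using hle u₀ v
  by_cases hD : D = 0
  · obtain rfl : C = 1 := by simpa [hD] using hCD
    subst hD
    simp only [NNReal.coe_zero, NNReal.coe_one, ENNReal.rpow_zero, ENNReal.rpow_one, mul_one]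
    refine lintegral_mono fun u => ?_
    by_cases hu : F u = 0
    · simp [hu]
    · simpa [sMean_zero _ _ hu hv₀] using hle u v₀
  refine geom_mean_le_of_forall_coe h0.1 h0.2 fun i j hi hj hiI hjJ => ?_
  have hi' : (i : ℝ≥0∞) ≠ 0 := by simpa using hi
  have hj' : (j : ℝ≥0∞) ≠ 0 := by simpa using hj
  -- Dividing `F` by `i ≤ I`, `G` by `j ≤ J` and `h` by `Z` makes both integrals on the left at
  -- least `1`. The factors `C^(-k)` and `D^(-k)` cancel the Jacobians and turn `negMean` into a
  -- weighted mean, which the geometric mean dominates.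
  set Z := (i : ℝ≥0∞) ^ (C : ℝ) * (j : ℝ≥0∞) ^ (D : ℝ) with hZ
  have hpt : ∀ u v, negMean (Module.finrank ℝ E)
      ((C : ℝ≥0∞) ^ (-(Module.finrank ℝ E : ℝ)) * (i : ℝ≥0∞)⁻¹ * F u)
      ((D : ℝ≥0∞) ^ (-(Module.finrank ℝ E : ℝ)) * (j : ℝ≥0∞)⁻¹ * G v)
      ≤ Z⁻¹ * h ((C : ℝ) • u + (D : ℝ) • v) := by
    intro u v
    by_cases hz : F u = 0 ∨ G v = 0
    · refine ((negMean_le_min hk _ _).trans ?_).trans zero_le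
      rcases hz with hz | hz <;> simp [hz]
    push Not at hz
    rw [mul_assoc, mul_assoc, negMean_const_mul hk hC hD]
    refine (weighted_negMean_le_geom_mean hk hCD (by simp [hz.1]) (by simp [hz.2])
      (ENNReal.mul_ne_top (by simpa using hi) (hF' u))
      (ENNReal.mul_ne_top (by simpa using hj) (hG' v))).trans ?_
    refine le_trans (le_of_eq ?_) (mul_le_mul' le_rfl (hle u v))
    rw [sMean_zero _ _ hz.1 hz.2, ENNReal.mul_rpow_of_nonneg _ _ C.coe_nonneg,
      ENNReal.mul_rpow_of_nonneg _ _ D.coe_nonneg, hZ, ENNReal.inv_rpow, ENNReal.inv_rpow,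
      ENNReal.mul_inv (Or.inr (ENNReal.rpow_ne_top_of_nonneg D.coe_nonneg ENNReal.coe_ne_top))
        (Or.inl (ENNReal.rpow_ne_top_of_nonneg C.coe_nonneg ENNReal.coe_ne_top))]
    ring
  have hZ0 : Z ≠ 0 := mul_ne_zero
    (ENNReal.rpow_pos (pos_iff_ne_zero.2 hi') ENNReal.coe_ne_top).ne'
    (ENNReal.rpow_pos (pos_iff_ne_zero.2 hj') ENNReal.coe_ne_top).ne'
  have hZt : Z ≠ ∞ := ENNReal.mul_ne_top
    (ENNReal.rpow_ne_top_of_nonneg C.coe_nonneg ENNReal.coe_ne_top)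
    (ENNReal.rpow_ne_top_of_nonneg D.coe_nonneg ENNReal.coe_ne_top)
  have key := min_lintegral_le_of_negMean_le hE hC hD hF hG (hh.const_mul Z⁻¹) _ _ hpt
  have e : ∀ {c i : ℝ≥0} {I : ℝ≥0∞} (_ : c ≠ 0) (_ : i ≠ 0) (_ : (i : ℝ≥0∞) ≤ I),
      1 ≤ (c : ℝ≥0∞) ^ (Module.finrank ℝ E : ℝ) *
        ((c : ℝ≥0∞) ^ (-(Module.finrank ℝ E : ℝ)) * (i : ℝ≥0∞)⁻¹) * I := by
    intro c i I hc hi hI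
    rw [← mul_assoc, ← ENNReal.rpow_add _ _ (by simpa using hc) ENNReal.coe_ne_top,
      add_neg_cancel, ENNReal.rpow_zero, one_mul]
    rw [← ENNReal.inv_mul_cancel (a := (i : ℝ≥0∞)) (by simpa using hi) ENNReal.coe_ne_top]
    exact mul_le_mul' le_rfl hI
  have h1 : 1 ≤ Z⁻¹ * ∫⁻ w, h w := by
    rw [← lintegral_const_mul _ hh]
    exact (le_min (e hC hi hiI) (e hD hj hjJ)).trans key
  calc Z = Z * 1 := (mul_one Z).symm
    _ ≤ Z * (Z⁻¹ * ∫⁻ w, h w) := mul_le_mul' le_rfl h1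
    _ = ∫⁻ w, h w := by rw [← mul_assoc, ENNReal.mul_inv_cancel hZ0 hZt, one_mul]

end Integral

/-! ### The `L_p` coefficients and the sections of `K`. -/

theorem lpCoeffC_nonneg {p l t : ℝ} (hl : l ≤ 1) (ht : t ≤ 1) : 0 ≤ lpCoeffC p l t :=
  mul_nonneg (Real.rpow_nonneg (by linarith) _) (Real.rpow_nonneg (by linarith) _)

theorem lpCoeffD_nonneg {p l t : ℝ} (hl : 0 ≤ l) (ht : 0 ≤ t) : 0 ≤ lpCoeffD p l t :=
  mul_nonneg (Real.rpow_nonneg ht _) (Real.rpow_nonneg hl _)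

/-- AM-GM with weights `1/p` and `1 - 1/p` bounds each coefficient, and the two bounds add up to
`1`. -/
theorem lpCoeffC_add_lpCoeffD_le_one {p l t : ℝ} (hp : 1 ≤ p) (hl : l ∈ Set.Icc (0 : ℝ) 1)
    (ht : t ∈ Set.Icc (0 : ℝ) 1) : lpCoeffC p l t + lpCoeffD p l t ≤ 1 := by
  have hp0 : 0 ≤ 1 / p := by positivity
  have hp1 : 0 ≤ 1 - 1 / p := by
    rw [sub_nonneg, div_le_one (by linarith)]
    exact hp
  have h1 := Real.geom_mean_le_arith_mean2_weighted hp0 hp1 (sub_nonneg.2 ht.2)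
    (sub_nonneg.2 hl.2) (by ring)
  have h2 := Real.geom_mean_le_arith_mean2_weighted hp0 hp1 ht.1 hl.1 (by ring)
  unfold lpCoeffC lpCoeffD
  linarith

theorem lpCoeffC_self {p t : ℝ} (ht : t ≤ 1) : lpCoeffC p t t = 1 - t := by
  rw [lpCoeffC, ← Real.rpow_add' (sub_nonneg.2 ht) (by simp), add_sub_cancel, Real.rpow_one]

theorem lpCoeffD_self {p t : ℝ} (ht : 0 ≤ t) : lpCoeffD p t t = t := by
  rw [lpCoeffD, ← Real.rpow_add' ht (by simp), add_sub_cancel, Real.rpow_one]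

theorem Convex.smul_add_smul_mem_of_zero_mem {E : Type*} [AddCommGroup E] [Module ℝ E] {K : Set E}
    (hK : Convex ℝ K) (h0 : (0 : E) ∈ K) {x y : E} (hx : x ∈ K) (hy : y ∈ K) {C D : ℝ}
    (hC : 0 ≤ C) (hD : 0 ≤ D) (hCD : C + D ≤ 1) : C • x + D • y ∈ K := by
  rcases eq_or_lt_of_le (add_nonneg hC hD) with h | h
  · have h1 : C = 0 := by linarith
    have h2 : D = 0 := by linarith
    simpa [h1, h2] using h0
  · have h3 := hK hx hy (div_nonneg hC h.le) (div_nonneg hD h.le)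
      (by rw [← add_div, div_self h.ne'])
    have h4 := hK.smul_mem_of_zero_mem h0 h3 ⟨h.le, hCD⟩
    rwa [smul_add, smul_smul, smul_smul, mul_div_cancel₀ _ h.ne', mul_div_cancel₀ _ h.ne'] at h4

section Section

variable {n : ℕ} (f : EuclideanSpace ℝ (Fin n) → ℝ≥0) (K : Set (EuclideanSpace ℝ (Fin n)))
  (H : Submodule ℝ (EuclideanSpace ℝ (Fin n)))

/-- The density of the section by `x + H`, extended by zero. -/
noncomputable def sectionDensity (x : EuclideanSpace ℝ (Fin n)) (u : H) : ℝ≥0∞ :=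
  K.indicator (fun z => (f z : ℝ≥0∞)) (x + (u : EuclideanSpace ℝ (Fin n)))

variable {f K H}

theorem measurable_sectionDensity (hf : Measurable f) (hK : MeasurableSet K)
    (x : EuclideanSpace ℝ (Fin n)) : Measurable (sectionDensity f K H x) :=
  (hf.coe_nnreal_ennreal.indicator hK).comp (by fun_prop)

theorem sectionDensity_ne_top (x : EuclideanSpace ℝ (Fin n)) (u : H) :
    sectionDensity f K H x u ≠ ∞ := by
  unfold sectionDensity
  by_cases h : x + (u : EuclideanSpace ℝ (Fin n)) ∈ K <;> simp [h]

theorem sectionMass_eq_lintegral (hK : MeasurableSet K) (x : EuclideanSpace ℝ (Fin n)) :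
    sectionMass f K H x = ∫⁻ u, sectionDensity f K H x u := by
  have hm : Measurable fun u : H => x + (u : EuclideanSpace ℝ (Fin n)) := by fun_prop
  have hS : MeasurableSet {u : H | x + (u : EuclideanSpace ℝ (Fin n)) ∈ K} := hm hK
  rw [sectionMass, ← lintegral_indicator hS]
  rfl

/-- Outside `K` the cut-off is harmless because the mean vanishes with either argument; inside, `C +
D ≤ 1` and `0 ∈ K` keep the combination in `K`. -/
theorem sMean_sectionDensity_le (hK : Convex ℝ K) (h0 : (0 : EuclideanSpace ℝ (Fin n)) ∈ K)
    {s : EReal} {C D : ℝ≥0} (hCD : C + D ≤ 1)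
    (hf : ∀ x y, sMean s C D (f x) (f y) ≤ f ((C : ℝ) • x + (D : ℝ) • y))
    (x y : EuclideanSpace ℝ (Fin n)) (u v : H) :
    sMean s C D (sectionDensity f K H x u) (sectionDensity f K H y v)
      ≤ sectionDensity f K H ((C : ℝ) • x + (D : ℝ) • y) ((C : ℝ) • u + (D : ℝ) • v) := by
  unfold sectionDensity
  by_cases hx : x + (u : EuclideanSpace ℝ (Fin n)) ∈ K
  swap
  · rw [sMean_eq_zero (Or.inl (Set.indicator_of_notMem hx _))]
    exact zero_le
  by_cases hy : y + (v : EuclideanSpace ℝ (Fin n)) ∈ K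
  swap
  · rw [sMean_eq_zero (Or.inr (Set.indicator_of_notMem hy _))]
    exact zero_le
  have e : (C : ℝ) • x + (D : ℝ) • y + (((C : ℝ) • u + (D : ℝ) • v : H) :
      EuclideanSpace ℝ (Fin n)) = (C : ℝ) • (x + u) + (D : ℝ) • (y + v) := by
    push_cast
    module
  rw [e, Set.indicator_of_mem hx, Set.indicator_of_mem hy, Set.indicator_of_mem
    (hK.smul_add_smul_mem_of_zero_mem h0 hx hy C.coe_nonneg D.coe_nonneg (by exact_mod_cast hCD))]
  exact hf _ _

end Section

theorem corollaryt (n j : ℕ) (hj : j < n) (p : ℝ) (hp : 1 ≤ p) (s : EReal)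
    (K : Set (EuclideanSpace ℝ (Fin n))) (hKconv : Convex ℝ K) (hKcomp : IsCompact K)
    (hK0 : (0 : EuclideanSpace ℝ (Fin n)) ∈ interior K)
    (H : Submodule ℝ (EuclideanSpace ℝ (Fin n))) (hH : Module.finrank ℝ H = n - j)
    (f : EuclideanSpace ℝ (Fin n) → ℝ≥0) (hf : Measurable f)
    (hfconc : IsLpConcave p s (fun z => (f z : ℝ≥0∞))) :
    (((-(1 / ((n - j : ℕ) : ℝ)) : ℝ) : EReal) ≤ s → s ≠ 0 →
      IsLpConcave p (brunnExponent (n - j) s) (fun x => sectionMass f K H x)) ∧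
    (s = 0 → IsLpConcave 1 0 (fun x => sectionMass f K H x)) ∧
    (s < ((-(1 / ((n - j : ℕ) : ℝ)) : ℝ) : EReal) →
      IsLpQuasiConcave p (1 / (brunnExponent (n - j) s).toReal)
        (fun x => sectionMass f K H x)) := by
  have hE : 0 < Module.finrank ℝ H := by omega
  have hKm : MeasurableSet K := hKcomp.measurableSet
  have h0 := interior_subset hK0
  have hmeas : ∀ x, Measurable (sectionDensity f K H x) := measurable_sectionDensity hf hKm
  rw [← hH, ← neg_div]
  refine ⟨fun hs hs0 x y l hl t ht hCD => ?_, ?_, fun hs x y l hl t ht => ?_⟩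
  · have hle := fun x y => hfconc x y l hl t ht hCD
    have hsum := lpCoeffC_add_lpCoeffD_le_one hp hl ht
    simp only [sectionMass_eq_lintegral hKm]
    lift lpCoeffC p l t to ℝ≥0 using lpCoeffC_nonneg hl.2 ht.2 with C
    lift lpCoeffD p l t to ℝ≥0 using lpCoeffD_nonneg hl.1 ht.1 with D
    exact sMean_lintegral_le hE (by simpa using hCD) hs0 hs (hmeas x) (hmeas y) (hmeas _)
      (sMean_sectionDensity_le hKconv h0 (by exact_mod_cast hsum) hle x y)
  · rintro rfl x y l hl t ht -
    -- On the diagonal `λ = t` the coefficients are `1 - t` and `t` for every `p`, so `f` is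
    -- log-concave in the ordinary sense.
    have hle := fun x y => hfconc x y t ht t ht
      (by rw [lpCoeffC_self ht.2, lpCoeffD_self ht.1]; by_contra! h; linarith [h.1, h.2])
    simp only [sectionMass_eq_lintegral hKm]
    have e1 : lpCoeffC 1 l t = 1 - t := by simp [lpCoeffC]
    have e2 : lpCoeffD 1 l t = t := by simp [lpCoeffD]
    rw [lpCoeffC_self ht.2, lpCoeffD_self ht.1] at hle
    rw [e1, e2]
    have hsum : 1 - t + t = 1 := by ring
    generalize hC : 1 - t = C at *
    have hC0 : 0 ≤ C := hC ▸ sub_nonneg.2 ht.2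
    have ht0 := ht.1
    lift C to ℝ≥0 using hC0
    lift t to ℝ≥0 using ht0
    have hsum' : C + t = 1 := by exact_mod_cast hsum
    exact prekopa_leindler hE hsum' (hmeas x) (hmeas y) (hmeas _) (sectionDensity_ne_top x)
      (sectionDensity_ne_top y) (sMean_sectionDensity_le hKconv h0 hsum'.le hle x y)
  -- Quasi-concavity includes `C = D = 0`, which the hypothesis on `f` leaves out; nondegeneracy
  -- therefore stays an argument.
  · have hle := fun hCD x y => hfconc x y l hl t ht hCD
    have hsum := lpCoeffC_add_lpCoeffD_le_one hp hl ht
    simp only [sectionMass_eq_lintegral hKm]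
    lift lpCoeffC p l t to ℝ≥0 using lpCoeffC_nonneg hl.2 ht.2 with C
    lift lpCoeffD p l t to ℝ≥0 using lpCoeffD_nonneg hl.1 ht.1 with D
    simp only [ENNReal.ofReal_coe_nnreal]
    exact quasi_lintegral_le hE hs (hmeas x) (hmeas y) (hmeas _) fun hC _ =>
      sMean_sectionDensity_le hKconv h0 (by exact_mod_cast hsum)
        (hle (Or.inl (by exact_mod_cast hC))) x y
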